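/- Let $d\ge 2$ and $Y=[0,1]^d$; a function on $\mathbb R^d$ is $Y$-periodic if it is invariant under translation by every vector of $\mathbb Z^d$. Let $u\in C^3(\mathbb R^d)$ be a real-valued function whose gradient $\nabla u$ is $Y$-periodic, and let $X$ be its gradient flow: for each $x\in\mathbb R^d$, $X(\cdot,x)$ is the unique solution on $\mathbb R$ of $$X'(t,x)=\nabla u\big(X(t,x)\big),\qquad X(0,x)=x .$$ Assume that for almost every $x\in\mathbb R^d$ at least one of the trajectories $X([0,\infty),x)$ and $X((-\infty,0],x)$ is bounded in $\mathbb R^d$. Say that $\nabla u$ is isotropically realizable in the torus with the positive conductivity $\sigma$ if $\sigma:\mathbb R^d\to(0,\infty)$ is locally integrable and $Y$-periodic and $\operatorname{div}(\sigma\nabla u)=0$ in the sense of distributions on $\mathbb R^d$. Consider the two conditions (a) for every $x\in\mathbb R^d$, $\nabla u(x)=0$ implies $\Delta u(x)=0$; (b) there is a constant $C>0$ such that $\left|\int_0^t\Delta u\big(X(s,x)\big)\,ds\right|\le C$ for all $t\ge 0$ and all $x\in\mathbb R^d$. (i) If (a) and (b) hold, then $\nabla u$ is isotropically realizable in the torus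 with a positive conductivity $\sigma$ such that $\sigma$ and $\sigma^{-1}$ belong to $L^\infty(\mathbb R^d)$. (ii) Conversely, if $\nabla u$ is isotropically realizable in the torus with a positive conductivity $\sigma$ of class $C^1$ on $\mathbb R^d$, then (a) and (b) hold. -/

import Mathlib

open MeasureTheory Set
open scoped Gradient Laplacian ContDiff NNReal InnerProductSpace Manifold

/-- `Y`-periodicity, `Y = [0,1]^d` being the unit cube: invariance under translation by every
vector with integer coordinates. -/
def IsYPeriodic {d : ℕ} {β : Type*} (f : EuclideanSpace ℝ (Fin d) → β) : Prop :=
  ∀ k : Fin d → ℤ, Function.Periodic f (WithLp.toLp 2 fun i => (k i : ℝ))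

open Classical in
/-- The gradient flow `X(t,x)` of `u`: the value at time `t` of the solution on the whole of `ℝ` of
`X' = ∇u(X)`, `X(0) = x`. The default value is used only if there is no such solution; for `u` of
class `C²` with a periodic gradient this never happens, and the solution is unique, see
`gradientFlow_spec` and `eq_gradientFlow`. -/
noncomputable def gradientFlow {d : ℕ} (u : EuclideanSpace ℝ (Fin d) → ℝ) (t : ℝ)
    (x : EuclideanSpace ℝ (Fin d)) : EuclideanSpace ℝ (Fin d) :=
  if h : ∃ γ : ℝ → EuclideanSpace ℝ (Fin d), γ 0 = x ∧ IsIntegralCurve γ (fun _ => ∇ u)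
  then h.choose t else x

/-- `div (σ ∇u) = 0` in the sense of distributions on `ℝ^d`. -/
def DivSigmaGradEqZero {d : ℕ} (σ u : EuclideanSpace ℝ (Fin d) → ℝ) : Prop :=
  ∀ φ : EuclideanSpace ℝ (Fin d) → ℝ, ContDiff ℝ ∞ φ → HasCompactSupport φ →
    ∫ x, σ x * ⟪∇ u x, ∇ φ x⟫_ℝ = 0

/-- `∇u` is isotropically realizable in the torus with the positive conductivity `σ`: the function
`σ` is positive, locally integrable and `Y`-periodic, and `div (σ ∇u) = 0` in `ℝ^d`. -/
structure IsRealizableInTorusWith {d : ℕ} (u σ : EuclideanSpace ℝ (Fin d) → ℝ) : Prop where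
  pos : ∀ x, 0 < σ x
  locallyIntegrable : LocallyIntegrable σ volume
  periodic : IsYPeriodic σ
  div_eq_zero : DivSigmaGradEqZero σ u

/-- The laplacian of `u` vanishes at every critical point of `u`. -/
def LaplacianVanishesAtCriticalPoints {d : ℕ} (u : EuclideanSpace ℝ (Fin d) → ℝ) : Prop :=
  ∀ x, ∇ u x = 0 → Δ u x = 0

/-- The integrals of the laplacian of `u` along the forward gradient flow are uniformly bounded. -/
def LaplacianIntegralsBounded {d : ℕ} (u : EuclideanSpace ℝ (Fin d) → ℝ) : Prop :=
  ∃ C : ℝ, 0 < C ∧ ∀ t : ℝ, 0 ≤ t → ∀ x, |∫ s in (0 : ℝ)..t, Δ u (gradientFlow u s x)| ≤ C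

/-- A continuous `Y`-periodic map is bounded. -/
theorem IsYPeriodic.exists_norm_le {d : ℕ} {β : Type*} [NormedAddCommGroup β]
    {f : EuclideanSpace ℝ (Fin d) → β} (hf : IsYPeriodic f) (hc : Continuous f) :
    ∃ K : ℝ≥0, ∀ x, ‖f x‖ ≤ K := by
  have hK : IsCompact ((WithLp.toLp 2 : (Fin d → ℝ) → EuclideanSpace ℝ (Fin d)) ''
      (Icc (0 : Fin d → ℝ) 1)) :=
    isCompact_Icc.image (PiLp.continuous_toLp 2 _)
  obtain ⟨C, hC⟩ := hK.exists_bound_of_continuousOn hc.continuousOn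
  refine ⟨C.toNNReal, fun x => ?_⟩
  have h1 := hf (fun i => ⌊x i⌋) (WithLp.toLp 2 fun i => Int.fract (x i))
  have h2 : (WithLp.toLp 2 fun i => Int.fract (x i)) + (WithLp.toLp 2 fun i => (⌊x i⌋ : ℝ)) = x := by
    ext i
    simp
  rw [h2] at h1
  rw [h1]
  refine (hC _ ⟨_, ⟨fun i => Int.fract_nonneg _, fun i => (Int.fract_lt_one _).le⟩, rfl⟩).trans ?_
  exact Real.le_coe_toNNReal C

theorem contDiff_gradient {d : ℕ} {u : EuclideanSpace ℝ (Fin d) → ℝ} (hu : ContDiff ℝ 2 u) :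
    ContDiff ℝ 1 (∇ u) :=
  (InnerProductSpace.toDual ℝ (EuclideanSpace ℝ (Fin d))).symm.contDiff.comp
    (hu.fderiv_right (m := 1) (by norm_num))

theorem exists_lipschitzWith_gradient {d : ℕ} {u : EuclideanSpace ℝ (Fin d) → ℝ}
    (hu : ContDiff ℝ 2 u) (hper : IsYPeriodic (∇ u)) : ∃ K : ℝ≥0, LipschitzWith K (∇ u) := by
  have h := contDiff_gradient hu
  have hp : IsYPeriodic (fderiv ℝ (∇ u)) := by
    intro k x
    rw [← fderiv_comp_add_right]
    congr 1
    exact funext (hper k)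
  obtain ⟨K, hK⟩ := hp.exists_norm_le (h.continuous_fderiv one_ne_zero)
  exact ⟨K, lipschitzWith_of_nnnorm_fderiv_le (h.differentiable one_ne_zero) fun x => hK x⟩

/-- Global existence for the gradient system. -/
theorem exists_gradientTrajectory {d : ℕ} {u : EuclideanSpace ℝ (Fin d) → ℝ}
    (hu : ContDiff ℝ 2 u) (hper : IsYPeriodic (∇ u)) (x : EuclideanSpace ℝ (Fin d)) :
    ∃ γ : ℝ → EuclideanSpace ℝ (Fin d), γ 0 = x ∧ IsIntegralCurve γ (fun _ => ∇ u) := by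
  have hC := contDiff_gradient hu
  obtain ⟨K, hK⟩ := exists_lipschitzWith_gradient hu hper
  obtain ⟨L, hL⟩ := hper.exists_norm_le hC.continuous
  obtain ⟨w, hw⟩ : ∃ w : EuclideanSpace ℝ (Fin d) → EuclideanSpace ℝ (Fin d), w = ∇ u := ⟨_, rfl⟩
  rw [← hw] at hC hK hL ⊢
  have hv : ContMDiff 𝓘(ℝ, EuclideanSpace ℝ (Fin d)) 𝓘(ℝ, EuclideanSpace ℝ (Fin d)).tangent 1
      (fun y => (⟨y, w y⟩ : TangentBundle 𝓘(ℝ, EuclideanSpace ℝ (Fin d)) _)) :=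
    contMDiff_vectorSpace_iff_contDiff.2 hC
  obtain ⟨γ, h0, hγ⟩ := exists_isMIntegralCurve_of_isMIntegralCurveOn
    (I := 𝓘(ℝ, EuclideanSpace ℝ (Fin d))) (v := w) hv one_pos (fun y => by
      have hpl : IsPicardLindelof (fun _ : ℝ => w) (tmin := -1) (tmax := 1) ⟨0, by simp⟩ y
          L 0 L K :=
        { lipschitzOnWith := fun _ _ => hK.lipschitzOnWith
          continuousOn := fun _ _ => continuousOn_const
          norm_le := fun _ _ z _ => hL z
          mul_max_le := by simp }
      obtain ⟨α, h0, hα⟩ := hpl.exists_eq_forall_mem_Icc_hasDerivWithinAt₀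
      refine ⟨α, h0, fun t ht => ?_⟩
      exact ((hα t ⟨ht.1.le, ht.2.le⟩).hasDerivAt
        (Icc_mem_nhds ht.1 ht.2)).hasFDerivAt.hasMFDerivAt.hasMFDerivWithinAt) x
  refine ⟨γ, h0, fun t => ?_⟩
  have h : HasFDerivAt γ (ContinuousLinearMap.toSpanSingleton ℝ (w (γ t))) t :=
    hasMFDerivAt_iff_hasFDerivAt.1 (hγ t)
  simpa using h.hasDerivAt

/-- The gradient flow solves the gradient system. -/
theorem gradientFlow_spec {d : ℕ} {u : EuclideanSpace ℝ (Fin d) → ℝ}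
    (hu : ContDiff ℝ 2 u) (hper : IsYPeriodic (∇ u)) (x : EuclideanSpace ℝ (Fin d)) :
    gradientFlow u 0 x = x ∧
      ∀ t, HasDerivAt (fun s => gradientFlow u s x) (∇ u (gradientFlow u t x)) t := by
  have h := exists_gradientTrajectory hu hper x
  have h1 : (fun s => gradientFlow u s x) = h.choose := by
    funext s
    simp only [gradientFlow, dif_pos h]
  have h2 : ∀ s, gradientFlow u s x = h.choose s := congrFun h1
  rw [h1]
  refine ⟨(h2 0).trans h.choose_spec.1, fun t => ?_⟩
  rw [h2]
  exact h.choose_spec.2 t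

/-- Uniqueness for the gradient system. -/
theorem eq_gradientFlow {d : ℕ} {u : EuclideanSpace ℝ (Fin d) → ℝ}
    (hu : ContDiff ℝ 2 u) (hper : IsYPeriodic (∇ u)) {x : EuclideanSpace ℝ (Fin d)}
    {γ : ℝ → EuclideanSpace ℝ (Fin d)} (h0 : γ 0 = x) (hγ : ∀ t, HasDerivAt γ (∇ u (γ t)) t) :
    γ = fun t => gradientFlow u t x := by
  obtain ⟨K, hK⟩ := exists_lipschitzWith_gradient hu hper
  obtain ⟨g0, hg⟩ := gradientFlow_spec hu hper x
  exact ODE_solution_unique_univ (v := fun _ => ∇ u) (s := fun _ => univ) (t₀ := 0)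
    (fun _ => hK.lipschitzOnWith) (fun t => ⟨hγ t, mem_univ _⟩) (fun t => ⟨hg t, mem_univ _⟩)
    (h0.trans g0.symm)

/-! By Liouville, the flow distorts volume by `exp` of I(t,x), the integral of Δu along the
trajectory of x on [0,t]. Hence div(σ∇u) = 0 says that the measure σ dx is invariant under the flow,
that is, σ(X(t,x)) = σ(x) exp(-I(t,x)).

For (i), the cocycle identity I(s+t,x) = I(t,x) + I(s,X(t,x)) extends the bound (b) to all real
times, so that S(x) = sup over real t of I(t,x) is finite. The same identity gives S(X(t,x)) = S(x)
- I(t,x), and σ = exp S has the required transport law and bounds. To return to the weak equation, ∫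
σφ is pulled back by X(t,·) and differentiated at t = 0+
(`divSigmaGradEqZero_of_forall_gradientFlow`). Only a first order form of Liouville's formula is
needed: the jacobian is 1 + tΔu + o(t), uniformly where X(t,·) is differentiable. That is almost
everywhere by Rademacher, because the flow is Lipschitz by Grönwall; smooth dependence on the
initial point plays no role.

For (ii), a C¹ conductivity satisfies ∇σ·∇u + σΔu = 0 pointwise. At a critical point this reads σΔu
= 0. Along a trajectory it says that -log σ is a primitive of Δu, and log σ is bounded by
periodicity. -/

theorem IsYPeriodic.fderiv {d : ℕ} {β : Type*} [NormedAddCommGroup β] [NormedSpace ℝ β]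
    {f : EuclideanSpace ℝ (Fin d) → β} (hf : IsYPeriodic f) : IsYPeriodic (fderiv ℝ f) := by
  intro k x
  rw [← fderiv_comp_add_right]
  congr 1
  exact funext (hf k)

/-- A `Y`-periodic map of class `C¹` is globally Lipschitz. -/
theorem IsYPeriodic.exists_lipschitzWith {d : ℕ} {β : Type*} [NormedAddCommGroup β]
    [NormedSpace ℝ β] {f : EuclideanSpace ℝ (Fin d) → β} (hf : IsYPeriodic f)
    (hc : ContDiff ℝ 1 f) : ∃ K : ℝ≥0, LipschitzWith K f := by
  obtain ⟨K, hK⟩ := hf.fderiv.exists_norm_le (hc.continuous_fderiv one_ne_zero)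
  exact ⟨K, lipschitzWith_of_nnnorm_fderiv_le (hc.differentiable one_ne_zero) fun x => hK x⟩

/-- Two trajectories of an autonomous Lipschitz vector field separate at most exponentially, both
forward and backward in time. -/
theorem dist_le_of_integralCurves {E : Type*} [NormedAddCommGroup E] [NormedSpace ℝ E]
    {v : E → E} {K : ℝ≥0} (hv : LipschitzWith K v) {f g : ℝ → E}
    (hf : ∀ t, HasDerivAt f (v (f t)) t) (hg : ∀ t, HasDerivAt g (v (g t)) t) (t : ℝ) :
    dist (f t) (g t) ≤ dist (f 0) (g 0) * Real.exp (K * |t|) := by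
  have key : ∀ {v : E → E} {f g : ℝ → E}, LipschitzWith K v →
      (∀ t, HasDerivAt f (v (f t)) t) → (∀ t, HasDerivAt g (v (g t)) t) → ∀ {t : ℝ}, 0 ≤ t →
      dist (f t) (g t) ≤ dist (f 0) (g 0) * Real.exp (K * t) := by
    intro v f g hv hf hg t ht
    have h := dist_le_of_trajectories_ODE (v := fun _ => v) (K := K) (f := f) (g := g) (a := 0)
      (b := t) (fun _ => hv) (fun s _ => (hf s).continuousAt.continuousWithinAt)
      (fun s _ => (hf s).hasDerivWithinAt) (fun s _ => (hg s).continuousAt.continuousWithinAt)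
      (fun s _ => (hg s).hasDerivWithinAt) le_rfl t ⟨ht, le_rfl⟩
    simpa using h
  rcases le_total 0 t with ht | ht
  · rw [abs_of_nonneg ht]
    exact key hv hf hg ht
  · rw [abs_of_nonpos ht]
    have hrev : ∀ {f : ℝ → E}, (∀ t, HasDerivAt f (v (f t)) t) →
        ∀ t, HasDerivAt (fun s => f (-s)) ((fun x => -v x) (f (-t))) t := by
      intro f hf t
      simpa [Function.comp_def] using (hf (-t)).scomp t (hasDerivAt_neg t)
    simpa using key (v := fun x => -v x) hv.neg (hrev hf) (hrev hg) (neg_nonneg.2 ht)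

/-! ### The gradient flow: group law, periodicity, Lipschitz estimates -/

section Flow

variable {d : ℕ} {u : EuclideanSpace ℝ (Fin d) → ℝ}

theorem hasDerivAt_gradientFlow (hu : ContDiff ℝ 2 u) (hper : IsYPeriodic (∇ u))
    (x : EuclideanSpace ℝ (Fin d)) (t : ℝ) :
    HasDerivAt (fun s => gradientFlow u s x) (∇ u (gradientFlow u t x)) t :=
  (gradientFlow_spec hu hper x).2 t

theorem gradientFlow_zero (hu : ContDiff ℝ 2 u) (hper : IsYPeriodic (∇ u))
    (x : EuclideanSpace ℝ (Fin d)) : gradientFlow u 0 x = x :=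
  (gradientFlow_spec hu hper x).1

theorem continuous_gradientFlow_left (hu : ContDiff ℝ 2 u) (hper : IsYPeriodic (∇ u))
    (x : EuclideanSpace ℝ (Fin d)) : Continuous fun t => gradientFlow u t x :=
  continuous_iff_continuousAt.2 fun t => (hasDerivAt_gradientFlow hu hper x t).continuousAt

theorem gradientFlow_add (hu : ContDiff ℝ 2 u) (hper : IsYPeriodic (∇ u)) (s t : ℝ)
    (x : EuclideanSpace ℝ (Fin d)) :
    gradientFlow u (s + t) x = gradientFlow u s (gradientFlow u t x) := by
  refine congrFun (eq_gradientFlow hu hper (x := gradientFlow u t x)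
    (γ := fun s => gradientFlow u (s + t) x) (by simp) fun r => ?_) s
  exact (hasDerivAt_gradientFlow hu hper x (r + t)).comp_add_const r t

theorem gradientFlow_periodic (hu : ContDiff ℝ 2 u) (hper : IsYPeriodic (∇ u)) (t : ℝ)
    (k : Fin d → ℤ) (x : EuclideanSpace ℝ (Fin d)) :
    gradientFlow u t (x + WithLp.toLp 2 fun i => (k i : ℝ)) =
      gradientFlow u t x + WithLp.toLp 2 fun i => (k i : ℝ) := by
  refine (congrFun (eq_gradientFlow hu hper (x := x + WithLp.toLp 2 fun i => (k i : ℝ))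
    (γ := fun s => gradientFlow u s x + WithLp.toLp 2 fun i => (k i : ℝ)) ?_ fun r => ?_) t).symm
  · rw [gradientFlow_zero hu hper]
  · rw [hper k]
    exact (hasDerivAt_gradientFlow hu hper x r).add_const _

theorem gradientFlow_bijective (hu : ContDiff ℝ 2 u) (hper : IsYPeriodic (∇ u)) (t : ℝ) :
    Function.Bijective (gradientFlow u t) := by
  refine Function.bijective_iff_has_inverse.2 ⟨gradientFlow u (-t), fun x => ?_, fun x => ?_⟩
  · rw [← gradientFlow_add hu hper, neg_add_cancel, gradientFlow_zero hu hper]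
  · rw [← gradientFlow_add hu hper, add_neg_cancel, gradientFlow_zero hu hper]

theorem dist_gradientFlow_le (hu : ContDiff ℝ 2 u) (hper : IsYPeriodic (∇ u)) {K : ℝ≥0}
    (hK : LipschitzWith K (∇ u)) (t : ℝ) (x y : EuclideanSpace ℝ (Fin d)) :
    dist (gradientFlow u t x) (gradientFlow u t y) ≤ dist x y * Real.exp (K * |t|) := by
  simpa only [gradientFlow_zero hu hper] using dist_le_of_integralCurves hK
    (hasDerivAt_gradientFlow hu hper x) (hasDerivAt_gradientFlow hu hper y) t

theorem lipschitzWith_gradientFlow (hu : ContDiff ℝ 2 u) (hper : IsYPeriodic (∇ u)) {K : ℝ≥0}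
    (hK : LipschitzWith K (∇ u)) (t : ℝ) :
    LipschitzWith (Real.exp (K * |t|)).toNNReal (gradientFlow u t) :=
  LipschitzWith.of_dist_le_mul fun x y => by
    rw [Real.coe_toNNReal _ (Real.exp_pos _).le, mul_comm]
    exact dist_gradientFlow_le hu hper hK t x y

/-- Continuity in time for a fixed point combines with the Grönwall bound in space, which is locally
uniform in time. -/
theorem continuous_gradientFlow (hu : ContDiff ℝ 2 u) (hper : IsYPeriodic (∇ u)) :
    Continuous fun p : ℝ × EuclideanSpace ℝ (Fin d) => gradientFlow u p.1 p.2 := by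
  obtain ⟨K, hK⟩ := exists_lipschitzWith_gradient hu hper
  refine continuous_iff_continuousAt.2 fun ⟨t, x⟩ => ?_
  have h1 : Filter.Tendsto (fun p : ℝ × EuclideanSpace ℝ (Fin d) =>
      dist p.2 x * Real.exp (K * |p.1|) + dist (gradientFlow u p.1 x) (gradientFlow u t x))
      (nhds (t, x)) (nhds 0) := by
    have hc : Continuous (fun p : ℝ × EuclideanSpace ℝ (Fin d) =>
        dist p.2 x * Real.exp (K * |p.1|) +
          dist (gradientFlow u p.1 x) (gradientFlow u t x)) := by
      have := (continuous_gradientFlow_left hu hper x).comp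
        (continuous_fst (X := ℝ) (Y := EuclideanSpace ℝ (Fin d)))
      exact (by fun_prop : Continuous fun p : ℝ × EuclideanSpace ℝ (Fin d) =>
        dist p.2 x * Real.exp (K * |p.1|)).add (this.dist continuous_const)
    simpa using hc.tendsto (t, x)
  refine tendsto_iff_dist_tendsto_zero.2 (squeeze_zero (fun _ => dist_nonneg) (fun p => ?_) h1)
  exact (dist_triangle _ (gradientFlow u p.1 x) _).trans
    (add_le_add_left (dist_gradientFlow_le hu hper hK p.1 p.2 x) _)

/-- Trajectories move with bounded speed. -/
theorem dist_gradientFlow_self_le (hu : ContDiff ℝ 2 u) (hper : IsYPeriodic (∇ u)) {L : ℝ≥0}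
    (hL : ∀ x, ‖∇ u x‖ ≤ L) (t : ℝ) (x : EuclideanSpace ℝ (Fin d)) :
    dist (gradientFlow u t x) x ≤ L * |t| := by
  have h := convex_univ.norm_image_sub_le_of_norm_hasDerivWithin_le (C := L) (x := (0 : ℝ))
    (y := t) (fun s _ => (hasDerivAt_gradientFlow hu hper x s).hasDerivWithinAt)
    (fun s _ => hL _) (mem_univ _) (mem_univ _)
  rw [gradientFlow_zero hu hper, sub_zero, Real.norm_eq_abs] at h
  rwa [dist_eq_norm]

/-- The remainder of the first order Taylor expansion of the flow in time is Lipschitz in space with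
a constant of second order in time. -/
theorem exists_norm_gradientFlow_sub_le (hu : ContDiff ℝ 3 u) (hper : IsYPeriodic (∇ u)) :
    ∃ M : ℝ≥0, ∀ t ∈ Icc (0 : ℝ) 1, LipschitzWith (M * (t ^ 2).toNNReal)
      (fun x => gradientFlow u t x - x - t • ∇ u x) := by
  have hu2 : ContDiff ℝ 2 u := hu.of_le (by norm_num)
  obtain ⟨K, hK⟩ := exists_lipschitzWith_gradient hu2 hper
  have hC2 : ContDiff ℝ 2 (∇ u) :=
    (InnerProductSpace.toDual ℝ (EuclideanSpace ℝ (Fin d))).symm.contDiff.comp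
      (hu.fderiv_right (m := 2) (by norm_num))
  -- This field gives the second time derivative of a trajectory. It is C¹ because u is C³, and
  -- periodic, hence globally Lipschitz; the factor exp K below is Grönwall for times at most 1.
  have hper' : IsYPeriodic (fun z => fderiv ℝ (∇ u) z (∇ u z)) := fun k x => by
    simp only [hper.fderiv k x, hper k x]
  obtain ⟨N, hN⟩ := hper'.exists_lipschitzWith
    ((hC2.fderiv_right (m := 1) (by norm_num)).clm_apply (hC2.of_le (by norm_num)))
  refine ⟨N * (Real.exp K).toNNReal, fun t ht => LipschitzWith.of_dist_le_mul fun x y => ?_⟩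
  have hq : ∀ z s, HasDerivAt (fun s => ∇ u (gradientFlow u s z))
      (fderiv ℝ (∇ u) (gradientFlow u s z) (∇ u (gradientFlow u s z))) s := fun z s =>
    ((hC2.differentiable (by norm_num)) _).hasFDerivAt.comp_hasDerivAt s
      (hasDerivAt_gradientFlow hu2 hper z s)
  have h1 : ∀ s ∈ Icc (0 : ℝ) t, ‖(∇ u (gradientFlow u s x) - ∇ u (gradientFlow u s y)) -
      (∇ u x - ∇ u y)‖ ≤ N * Real.exp K * dist x y * t := by
    intro s hs
    have h := norm_image_sub_le_of_norm_deriv_le_segment' (a := 0) (b := t)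
      (C := N * Real.exp K * dist x y)
      (fun r _ => ((hq x r).sub (hq y r)).hasDerivWithinAt) (fun r hr => ?_) s hs
    · simp only [Pi.sub_apply, gradientFlow_zero hu2 hper, sub_zero] at h
      exact h.trans (by gcongr; exact hs.2)
    · rw [← dist_eq_norm, mul_assoc]
      refine (hN.dist_le_mul _ _).trans ?_
      gcongr
      refine (dist_gradientFlow_le hu2 hper hK r x y).trans ?_
      rw [mul_comm]
      gcongr
      rw [abs_of_nonneg hr.1]
      exact mul_le_of_le_one_right K.2 (hr.2.le.trans ht.2)
  -- A second application of the mean value inequality: each one contributes a factor t.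
  have h2 := norm_image_sub_le_of_norm_deriv_le_segment' (a := 0) (b := t)
    (f := fun s => gradientFlow u s x - gradientFlow u s y - s • (∇ u x - ∇ u y))
    (C := N * Real.exp K * dist x y * t)
    (fun r _ => (((hasDerivAt_gradientFlow hu2 hper x r).sub
      (hasDerivAt_gradientFlow hu2 hper y r)).sub
      ((hasDerivAt_id r).smul_const (∇ u x - ∇ u y))).hasDerivWithinAt)
    (fun r hr => by
      rw [one_smul]
      exact h1 r ⟨hr.1, hr.2.le⟩) t ⟨ht.1, le_rfl⟩
  simp only [gradientFlow_zero hu2 hper, sub_zero, zero_smul] at h2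
  rw [dist_eq_norm]
  convert h2 using 1
  · congr 1
    rw [smul_sub]
    abel
  · push_cast
    rw [Real.coe_toNNReal _ (Real.exp_pos _).le, Real.coe_toNNReal _ (sq_nonneg t)]
    ring

end Flow

/-! ### Lipschitz images of null sets; the determinant near the identity -/

/-- Lebesgue measure and d-dimensional Hausdorff measure have the same null sets, and a Lipschitz
map multiplies the latter by at most a constant. -/
theorem volume_image_eq_zero_of_lipschitzWith {d : ℕ} {C : ℝ≥0}
    {f : EuclideanSpace ℝ (Fin d) → EuclideanSpace ℝ (Fin d)} (hf : LipschitzWith C f)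
    {s : Set (EuclideanSpace ℝ (Fin d))} (hs : volume s = 0) : volume (f '' s) = 0 := by
  have h1 : (volume : Measure (EuclideanSpace ℝ (Fin d))) ≪ μH[(d : ℝ)] :=
    Measure.absolutelyContinuous_isAddHaarMeasure _ _
  have h2 : (μH[(d : ℝ)] : Measure (EuclideanSpace ℝ (Fin d))) ≪ volume :=
    Measure.absolutelyContinuous_isAddHaarMeasure _ _
  refine h1 (le_antisymm ((hf.hausdorffMeasure_image_le d.cast_nonneg s).trans ?_) zero_le)
  rw [h2 hs, mul_zero]

/-- The determinant is multilinear in the rows, so its derivative sums the determinants with one row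
replaced; at the identity, replacing row i leaves the i-th diagonal entry. -/
theorem hasFDerivAt_matrix_det_one {n : Type*} [Fintype n] [DecidableEq n] :
    HasFDerivAt (fun A : n → n → ℝ => (Matrix.of A).det)
      (∑ i, (ContinuousLinearMap.proj (R := ℝ) (φ := fun _ : n => ℝ) i).comp
        (ContinuousLinearMap.proj (R := ℝ) (φ := fun _ : n => n → ℝ) i))
      (fun i => Pi.single i 1) := by
  let f : ContinuousMultilinearMap ℝ (fun _ : n => n → ℝ) ℝ :=
    { (Matrix.detRowAlternating : (n → ℝ) [⋀^n]→ₗ[ℝ] ℝ).toMultilinearMap with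
      cont := (continuous_id (X := Matrix n n ℝ)).matrix_det }
  have h := f.hasFDerivAt (fun i => Pi.single i 1)
  refine h.congr_fderiv (ContinuousLinearMap.ext fun A => ?_)
  rw [ContinuousMultilinearMap.linearDeriv_apply]
  simp only [sum_apply, ContinuousLinearMap.comp_apply,
    ContinuousLinearMap.proj_apply]
  refine Finset.sum_congr rfl fun i _ => ?_
  have h1 : (fun i => Pi.single i 1 : n → n → ℝ) = (1 : Matrix n n ℝ) := by
    ext i j
    simp [Matrix.one_apply, Pi.single_apply, eq_comm]
  have h2 : f (Function.update (fun i => Pi.single i 1) i (A i)) =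
      (Matrix.updateRow (1 : Matrix n n ℝ) i (A i)).det := by
    rw [h1]
    rfl
  rw [h2, ← Matrix.cramer_transpose_apply, Matrix.transpose_one, Matrix.cramer_one]
  rfl

/-- The derivative of the determinant at the identity is the trace. -/
theorem hasFDerivAt_det_one {d : ℕ} :
    HasFDerivAt (fun A : EuclideanSpace ℝ (Fin d) →L[ℝ] EuclideanSpace ℝ (Fin d) => A.det)
      (∑ i : Fin d, (EuclideanSpace.proj i : EuclideanSpace ℝ (Fin d) →L[ℝ] ℝ).comp
        (ContinuousLinearMap.apply ℝ (EuclideanSpace ℝ (Fin d)) (EuclideanSpace.single i (1 : ℝ))))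
      (ContinuousLinearMap.id ℝ _) := by
  -- Row i is the image of the i-th basis vector, so this is the transposed matrix, with the same
  -- determinant.
  let T : (EuclideanSpace ℝ (Fin d) →L[ℝ] EuclideanSpace ℝ (Fin d)) →L[ℝ] (Fin d → Fin d → ℝ) :=
    ContinuousLinearMap.pi fun i => ContinuousLinearMap.pi fun j =>
      (EuclideanSpace.proj j : EuclideanSpace ℝ (Fin d) →L[ℝ] ℝ).comp
        (ContinuousLinearMap.apply ℝ (EuclideanSpace ℝ (Fin d)) (EuclideanSpace.single i (1 : ℝ)))
  have hT : ∀ A, A.det = (Matrix.of (T A)).det := by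
    intro A
    rw [ContinuousLinearMap.det, ← LinearMap.det_toMatrix (EuclideanSpace.basisFun (Fin d) ℝ).toBasis,
      ← Matrix.det_transpose]
    congr 1
  have h1 : T (ContinuousLinearMap.id ℝ _) = fun i => Pi.single i 1 := by
    ext i j
    simp [T, Pi.single_apply]
  have h2 := (h1 ▸ hasFDerivAt_matrix_det_one).comp
    (ContinuousLinearMap.id ℝ (EuclideanSpace ℝ (Fin d))) T.hasFDerivAt
  have h3 : (fun A : EuclideanSpace ℝ (Fin d) →L[ℝ] EuclideanSpace ℝ (Fin d) => A.det) =
    (fun A : Fin d → Fin d → ℝ => (Matrix.of A).det) ∘ T := funext hT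
  rw [h3]
  refine h2.congr_fderiv (ContinuousLinearMap.ext fun A => ?_)
  simp [T]

/-! ### The jacobian of the flow -/

section Flow

variable {d : ℕ} {u : EuclideanSpace ℝ (Fin d) → ℝ}

theorem laplacian_eq_sum_fderiv_gradient (hu : ContDiff ℝ 2 u) (x : EuclideanSpace ℝ (Fin d)) :
    Δ u x = ∑ i, (fderiv ℝ (∇ u) x (EuclideanSpace.single i 1)) i := by
  rw [InnerProductSpace.laplacian_eq_iteratedFDeriv_orthonormalBasis u
    (EuclideanSpace.basisFun (Fin d) ℝ)]
  refine Finset.sum_congr rfl fun i _ => ?_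
  rw [iteratedFDeriv_two_apply]
  have h : fderiv ℝ u = fun y => InnerProductSpace.toDual ℝ (EuclideanSpace ℝ (Fin d)) (∇ u y) := by
    funext y
    simp [gradient]
  have h2 : HasFDerivAt (fderiv ℝ u)
      ((InnerProductSpace.toDual ℝ (EuclideanSpace ℝ (Fin d))).toContinuousLinearEquiv.toContinuousLinearMap.comp
        (fderiv ℝ (∇ u) x)) x := by
    rw [h]
    exact (InnerProductSpace.toDual ℝ
      (EuclideanSpace ℝ (Fin d))).toContinuousLinearEquiv.toContinuousLinearMap.hasFDerivAt.comp x
      ((contDiff_gradient hu).differentiable one_ne_zero x).hasFDerivAt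
  rw [h2.fderiv]
  simp [EuclideanSpace.inner_single_right]

theorem continuous_laplacian (hu : ContDiff ℝ 2 u) : Continuous (Δ u) := by
  rw [funext (laplacian_eq_sum_fderiv_gradient hu)]
  have := (contDiff_gradient hu).continuous_fderiv one_ne_zero
  fun_prop

theorem isYPeriodic_laplacian (hu : ContDiff ℝ 2 u) (hper : IsYPeriodic (∇ u)) :
    IsYPeriodic (Δ u) := fun k x => by
  simp only [laplacian_eq_sum_fderiv_gradient hu, hper.fderiv k x]

/-- Change of variables along the flow. -/
theorem integral_eq_integral_abs_det_gradientFlow (hu : ContDiff ℝ 2 u) (hper : IsYPeriodic (∇ u))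
    (t : ℝ) (g : EuclideanSpace ℝ (Fin d) → ℝ) :
    ∫ x, g x = ∫ x, |(fderiv ℝ (gradientFlow u t) x).det| * g (gradientFlow u t x) := by
  obtain ⟨K, hK⟩ := exists_lipschitzWith_gradient hu hper
  have hL := lipschitzWith_gradientFlow hu hper hK t
  have hbij := gradientFlow_bijective hu hper t
  have hs := measurableSet_of_differentiableAt ℝ (gradientFlow u t)
  have hnull : volume {x | DifferentiableAt ℝ (gradientFlow u t) x}ᶜ = 0 :=
    hL.ae_differentiableAt (μ := volume)
  have hs' : {x | DifferentiableAt ℝ (gradientFlow u t) x} =ᵐ[volume] univ :=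
    ae_eq_univ.2 hnull
  have him : gradientFlow u t '' {x | DifferentiableAt ℝ (gradientFlow u t) x} =ᵐ[volume] univ := by
    rw [ae_eq_univ, ← image_compl_eq hbij]
    exact volume_image_eq_zero_of_lipschitzWith hL hnull
  have h := integral_image_eq_integral_abs_det_fderiv_smul volume hs
    (fun x hx => (DifferentiableAt.hasFDerivAt hx).hasFDerivWithinAt) hbij.1.injOn g
  rw [setIntegral_congr_set him, setIntegral_congr_set hs', setIntegral_univ,
    setIntegral_univ] at h
  exact h

/-- First order expansion in time, uniform in space, of the jacobian of the flow. -/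
theorem eventually_abs_abs_det_gradientFlow_sub_le (hu : ContDiff ℝ 3 u)
    (hper : IsYPeriodic (∇ u)) {ε : ℝ} (hε : 0 < ε) :
    ∀ᶠ t in nhdsWithin 0 (Ioi 0), ∀ x, DifferentiableAt ℝ (gradientFlow u t) x →
      |(|(fderiv ℝ (gradientFlow u t) x).det| - 1 - t * Δ u x)| ≤ ε * t := by
  have hu2 : ContDiff ℝ 2 u := hu.of_le (by norm_num)
  have hC := contDiff_gradient hu2
  obtain ⟨K, hK⟩ := exists_lipschitzWith_gradient hu2 hper
  obtain ⟨M, hM⟩ := exists_norm_gradientFlow_sub_le hu hper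
  obtain ⟨D, hD⟩ := (isYPeriodic_laplacian hu2 hper).exists_norm_le (continuous_laplacian hu2)
  have hdet := hasFDerivAt_det_one (d := d)
  obtain ⟨T, hT⟩ : ∃ T : (EuclideanSpace ℝ (Fin d) →L[ℝ] EuclideanSpace ℝ (Fin d)) →L[ℝ] ℝ,
    T = ∑ i : Fin d, (EuclideanSpace.proj i : EuclideanSpace ℝ (Fin d) →L[ℝ] ℝ).comp
        (ContinuousLinearMap.apply ℝ (EuclideanSpace ℝ (Fin d))
          (EuclideanSpace.single i (1 : ℝ))) := ⟨_, rfl⟩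
  have htr : ∀ x, T (fderiv ℝ (∇ u) x) = Δ u x := fun x => by
    rw [laplacian_eq_sum_fderiv_gradient hu2, hT]
    simp
  rw [← hT] at hdet
  -- Since ‖A - id‖ ≤ t(K + M) below, this slope makes the error of the determinant at most εt/2;
  -- the trace of the flow remainder takes the other half.
  have hc : 0 < ε / (2 * (K + M + 1)) := by positivity
  obtain ⟨r, hr, hball⟩ := Metric.eventually_nhds_iff.1
    (hdet.isLittleO.def hc)
  have hsmall : ∀ a b : ℝ, 0 < b → ∀ᶠ t : ℝ in nhdsWithin 0 (Ioi 0), t * a < b := by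
    intro a b hb
    have : Filter.Tendsto (fun t : ℝ => t * a) (nhdsWithin 0 (Ioi 0)) (nhds 0) := by
      have h : Continuous fun t : ℝ => t * a := by fun_prop
      simpa using (h.tendsto 0).mono_left nhdsWithin_le_nhds
    exact this.eventually_lt_const hb
  filter_upwards [hsmall 1 1 one_pos, hsmall (K + M) r hr, hsmall (‖T‖ * M) (ε / 2) (by positivity),
    hsmall (D + ε) 1 one_pos, self_mem_nhdsWithin] with t h1 h2 h3 h4 ht x hx
  have ht0 : (0 : ℝ) < t := ht
  have htI : t ∈ Icc (0 : ℝ) 1 := ⟨ht0.le, by linarith⟩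
  set A := fderiv ℝ (gradientFlow u t) x with hA
  -- The Lipschitz constant of the Taylor remainder bounds its derivative.
  have hR : ‖A - ContinuousLinearMap.id ℝ _ - t • fderiv ℝ (∇ u) x‖ ≤ M * t ^ 2 := by
    have hd : HasFDerivAt (fun x => gradientFlow u t x - x - t • ∇ u x)
        (A - ContinuousLinearMap.id ℝ _ - t • fderiv ℝ (∇ u) x) x :=
      (hx.hasFDerivAt.sub (hasFDerivAt_id x)).sub
        (((hC.differentiable one_ne_zero) x).hasFDerivAt.const_smul t)
    have h := norm_fderiv_le_of_lipschitz ℝ (x₀ := x) (hM t htI)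
    rw [hd.fderiv] at h
    simpa [Real.coe_toNNReal _ (sq_nonneg t)] using h
  have hH : ‖fderiv ℝ (∇ u) x‖ ≤ K := norm_fderiv_le_of_lipschitz ℝ hK
  have hA1 : ‖A - ContinuousLinearMap.id ℝ _‖ ≤ t * (K + M) := by
    calc ‖A - ContinuousLinearMap.id ℝ _‖
        = ‖(A - ContinuousLinearMap.id ℝ _ - t • fderiv ℝ (∇ u) x) + t • fderiv ℝ (∇ u) x‖ := by
          rw [sub_add_cancel]
      _ ≤ M * t ^ 2 + t * K := by
          refine (norm_add_le _ _).trans (add_le_add hR ?_)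
          rw [norm_smul, Real.norm_of_nonneg ht0.le]
          gcongr
      _ ≤ t * (K + M) := by
          have : (M : ℝ) * t ^ 2 ≤ M * t := by
            gcongr
            nlinarith [htI.2]
          linarith
  have hdetA := hball (y := A) (by rw [dist_eq_norm]; exact hA1.trans_lt h2)
  have hid : (ContinuousLinearMap.id ℝ (EuclideanSpace ℝ (Fin d))).det = 1 := by
    simp [ContinuousLinearMap.det]
  rw [hid, Real.norm_eq_abs] at hdetA
  have hdetA' : |A.det - 1 - T (A - ContinuousLinearMap.id ℝ _)| ≤ ε / 2 * t := by
    refine hdetA.trans ?_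
    calc ε / (2 * (K + M + 1)) * ‖A - ContinuousLinearMap.id ℝ _‖
        ≤ ε / (2 * (K + M + 1)) * (t * (K + M + 1)) := by
          gcongr
          exact hA1.trans (mul_le_mul_of_nonneg_left (by linarith) ht0.le)
      _ = ε / 2 * t := by field_simp
  have hTA : |T (A - ContinuousLinearMap.id ℝ _) - t * Δ u x| ≤ ε / 2 * t := by
    have h : T (A - ContinuousLinearMap.id ℝ _) - t * Δ u x =
        T (A - ContinuousLinearMap.id ℝ _ - t • fderiv ℝ (∇ u) x) := by
      rw [map_sub T _ (t • _), map_smul, htr, smul_eq_mul]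
    rw [h, ← Real.norm_eq_abs]
    calc _ ≤ ‖T‖ * (M * t ^ 2) := T.le_opNorm_of_le hR
      _ = t * (‖T‖ * M) * t := by ring
      _ ≤ ε / 2 * t := by gcongr
  have hmain : |A.det - 1 - t * Δ u x| ≤ ε * t := by
    rw [abs_le] at *
    constructor <;> linarith
  have hpos : 0 ≤ A.det := by
    have hDx : |Δ u x| ≤ D := hD x
    have : -(t * D) ≤ t * Δ u x := by
      rw [← mul_neg]
      exact mul_le_mul_of_nonneg_left (neg_le_of_abs_le hDx) ht0.le
    have := (abs_le.1 hmain).1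
    linarith
  rwa [abs_of_nonneg hpos]

end Flow

/-- The integral of the laplacian of `u` along the gradient flow between the times `0` and `t`. -/
noncomputable def laplacianIntegral {d : ℕ} (u : EuclideanSpace ℝ (Fin d) → ℝ) (t : ℝ)
    (x : EuclideanSpace ℝ (Fin d)) : ℝ :=
  ∫ s in (0 : ℝ)..t, Δ u (gradientFlow u s x)

/-! ### Integrals of the laplacian along trajectories and the invariant density -/

section Flow

variable {d : ℕ} {u : EuclideanSpace ℝ (Fin d) → ℝ}

theorem laplacianIntegral_zero (x : EuclideanSpace ℝ (Fin d)) : laplacianIntegral u 0 x = 0 :=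
  intervalIntegral.integral_same

theorem continuous_laplacian_gradientFlow (hu : ContDiff ℝ 2 u) (hper : IsYPeriodic (∇ u))
    (x : EuclideanSpace ℝ (Fin d)) : Continuous fun s => Δ u (gradientFlow u s x) :=
  (continuous_laplacian hu).comp (continuous_gradientFlow_left hu hper x)

theorem hasDerivAt_laplacianIntegral (hu : ContDiff ℝ 2 u) (hper : IsYPeriodic (∇ u))
    (x : EuclideanSpace ℝ (Fin d)) (t : ℝ) :
    HasDerivAt (fun s => laplacianIntegral u s x) (Δ u (gradientFlow u t x)) t :=
  (continuous_laplacian_gradientFlow hu hper x).integral_hasStrictDerivAt 0 t |>.hasDerivAt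

theorem continuous_laplacianIntegral (hu : ContDiff ℝ 2 u) (hper : IsYPeriodic (∇ u)) (t : ℝ) :
    Continuous (laplacianIntegral u t) := by
  refine intervalIntegral.continuous_parametric_intervalIntegral_of_continuous'
    (f := fun x s => Δ u (gradientFlow u s x)) ?_ 0 t
  exact (continuous_laplacian hu).comp ((continuous_gradientFlow hu hper).comp continuous_swap)

theorem laplacianIntegral_add (hu : ContDiff ℝ 2 u) (hper : IsYPeriodic (∇ u)) (s t : ℝ)
    (x : EuclideanSpace ℝ (Fin d)) :
    laplacianIntegral u (s + t) x =
      laplacianIntegral u t x + laplacianIntegral u s (gradientFlow u t x) := by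
  have hc := continuous_laplacian_gradientFlow hu hper x
  have h : laplacianIntegral u s (gradientFlow u t x) =
      ∫ r in t..(s + t), Δ u (gradientFlow u r x) := by
    simp only [laplacianIntegral, ← gradientFlow_add hu hper]
    rw [intervalIntegral.integral_comp_add_right (fun r => Δ u (gradientFlow u r x)), zero_add]
  rw [h]
  exact (intervalIntegral.integral_add_adjacent_intervals (hc.intervalIntegrable _ _)
    (hc.intervalIntegrable _ _)).symm

theorem laplacianIntegral_periodic (hu : ContDiff ℝ 2 u) (hper : IsYPeriodic (∇ u)) (t : ℝ) :
    IsYPeriodic (laplacianIntegral u t) := fun k x => by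
  simp only [laplacianIntegral, gradientFlow_periodic hu hper,
    isYPeriodic_laplacian hu hper k _]

/-- For t < 0, the cocycle identity equates the integral from x, up to sign, with a forward one
started at X(t,x). -/
theorem LaplacianIntegralsBounded.exists_forall_abs_le (hu : ContDiff ℝ 2 u)
    (hper : IsYPeriodic (∇ u)) (h : LaplacianIntegralsBounded u) :
    ∃ C : ℝ, ∀ t x, |laplacianIntegral u t x| ≤ C := by
  obtain ⟨C, -, hC⟩ := h
  refine ⟨C, fun t x => ?_⟩
  rcases le_total 0 t with ht | ht
  · exact hC t ht x
  · have h := laplacianIntegral_add hu hper (-t) t x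
    rw [neg_add_cancel, laplacianIntegral_zero] at h
    rw [← neg_eq_of_add_eq_zero_left h.symm, abs_neg]
    exact hC _ (neg_nonneg.2 ht) _

/-- A bounded density that is transported by the flow of `∇u` as the inverse of the jacobian solves
`div (σ ∇u) = 0`. -/
theorem divSigmaGradEqZero_of_forall_gradientFlow (hu : ContDiff ℝ 3 u) (hper : IsYPeriodic (∇ u))
    {σ : EuclideanSpace ℝ (Fin d) → ℝ} (hσm : Measurable σ) {B : ℝ} (hσB : ∀ x, |σ x| ≤ B)
    (hσ : ∀ t x, σ (gradientFlow u t x) = σ x * Real.exp (-laplacianIntegral u t x)) :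
    DivSigmaGradEqZero σ u := by
  have hu2 : ContDiff ℝ 2 u := hu.of_le (by norm_num)
  intro φ hφ hφc
  have hφ1 : Differentiable ℝ φ := hφ.differentiable (by simp)
  have hφ' : Continuous (fderiv ℝ φ) := hφ.continuous_fderiv (by simp)
  obtain ⟨L, hL⟩ := hper.exists_norm_le (contDiff_gradient hu2).continuous
  obtain ⟨D, hD⟩ := (isYPeriodic_laplacian hu2 hper).exists_norm_le (continuous_laplacian hu2)
  obtain ⟨P, hP⟩ := hφc.exists_bound_of_continuous hφ.continuous
  obtain ⟨Q, hQ⟩ := (hφc.fderiv ℝ).exists_bound_of_continuous hφ'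
  obtain ⟨R, hR⟩ := hφc.isCompact.isBounded.subset_closedBall 0
  have hφR : ∀ x, x ∉ Metric.closedBall 0 R → φ x = 0 := fun x hx =>
    image_eq_zero_of_notMem_tsupport fun h => hx (hR h)
  have hB0 : 0 ≤ B := (abs_nonneg _).trans (hσB 0)
  have hP0 : 0 ≤ P := (norm_nonneg _).trans (hP 0)
  have hQ0 : 0 ≤ Q := (norm_nonneg _).trans (hQ 0)
  -- the test function, transported and weighted
  set m : EuclideanSpace ℝ (Fin d) → ℝ → ℝ := fun x t =>
    Real.exp (-laplacianIntegral u t x) * φ (gradientFlow u t x) with hm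
  have hm0 : ∀ x, m x 0 = φ x := fun x => by
    simp [hm, laplacianIntegral_zero, gradientFlow_zero hu2 hper]
  have hmd : ∀ x t, HasDerivAt (m x) (Real.exp (-laplacianIntegral u t x) *
      (fderiv ℝ φ (gradientFlow u t x) (∇ u (gradientFlow u t x)) -
        Δ u (gradientFlow u t x) * φ (gradientFlow u t x))) t := by
    intro x t
    have h1 := (hasDerivAt_laplacianIntegral hu2 hper x t).neg.exp
    have h2 := (hφ1 (gradientFlow u t x)).hasFDerivAt.comp_hasDerivAt t
      (hasDerivAt_gradientFlow hu2 hper x t)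
    refine (h1.mul h2).congr_deriv ?_
    simp only [Function.comp_apply, Pi.neg_apply]
    ring
  have hF : ∀ t ∈ Icc (0 : ℝ) 1, ∀ x, Real.exp (-laplacianIntegral u t x) ≤ Real.exp D := by
    intro t ht x
    refine Real.exp_le_exp.2 ((neg_le_abs _).trans ?_)
    have h := intervalIntegral.norm_integral_le_of_norm_le_const (a := 0) (b := t) (C := D)
      (f := fun s => Δ u (gradientFlow u s x)) fun s _ => hD _
    rw [sub_zero, abs_of_nonneg ht.1] at h
    exact h.trans (mul_le_of_le_one_right D.2 ht.2)
  have hmB : ∀ t ∈ Icc (0 : ℝ) 1, ∀ x, |m x t| ≤ Real.exp D * P := by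
    intro t ht x
    rw [hm, abs_mul, Real.abs_exp]
    exact mul_le_mul (hF t ht x) (hP _) (abs_nonneg _) (Real.exp_pos _).le
  have hmL : ∀ t ∈ Icc (0 : ℝ) 1, ∀ x, |m x t - m x 0| ≤ Real.exp D * (Q * L + D * P) * t := by
    intro t ht x
    have h := norm_image_sub_le_of_norm_deriv_le_segment' (a := 0) (b := t)
      (C := Real.exp D * (Q * L + D * P)) (fun r _ => (hmd x r).hasDerivWithinAt)
      (fun r hr => ?_) t ⟨ht.1, le_rfl⟩
    · simpa using h
    · rw [norm_mul, Real.norm_of_nonneg (Real.exp_pos _).le]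
      refine mul_le_mul (hF r ⟨hr.1, hr.2.le.trans ht.2⟩ x) ((norm_sub_le _ _).trans
        (add_le_add (ContinuousLinearMap.le_of_opNorm_le_of_le _ (hQ _) (hL _)) ?_))
        (norm_nonneg _) (Real.exp_pos _).le
      rw [norm_mul]
      exact mul_le_mul (hD _) (hP _) (norm_nonneg _) D.2
  have hmR : ∀ t ∈ Icc (0 : ℝ) 1, ∀ x, x ∉ Metric.closedBall 0 (R + L) → m x t = 0 := by
    intro t ht x hx
    rw [hm]
    simp only
    rw [hφR, mul_zero]
    intro h
    refine hx ?_
    rw [Metric.mem_closedBall] at h ⊢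
    have h1 := dist_gradientFlow_self_le hu2 hper hL t x
    rw [abs_of_nonneg ht.1, dist_comm] at h1
    have h2 : (L : ℝ) * t ≤ L := mul_le_of_le_one_right L.2 ht.2
    linarith [dist_triangle x (gradientFlow u t x) 0]
  set J : ℝ → EuclideanSpace ℝ (Fin d) → ℝ := fun t x =>
    |(fderiv ℝ (gradientFlow u t) x).det| with hJ
  have hJm : ∀ t, Measurable (J t) := fun t =>
    (ContinuousLinearMap.continuous_det.measurable.comp (measurable_fderiv ℝ _)).abs
  have hmm : ∀ t, Continuous fun x => m x t := fun t =>
    (continuous_laplacianIntegral hu2 hper t).neg.rexp.mul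
      (hφ.continuous.comp ((continuous_gradientFlow hu2 hper).comp (by fun_prop :
        Continuous fun x : EuclideanSpace ℝ (Fin d) => (t, x))))
  -- A sequence of times keeps the exceptional null sets of non-differentiability countable in
  -- number.
  have hτ : Filter.Tendsto (fun n : ℕ => (1 : ℝ) / (n + 1)) Filter.atTop
      (nhdsWithin 0 (Ioi 0)) :=
    tendsto_nhdsWithin_iff.2 ⟨tendsto_one_div_add_atTop_nhds_zero_nat,
      Filter.Eventually.of_forall fun n => by simpa using by positivity⟩
  obtain ⟨τ, hτ', hτ0, hτ1⟩ : ∃ τ : ℕ → ℝ, Filter.Tendsto τ Filter.atTop (nhdsWithin 0 (Ioi 0)) ∧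
      (∀ n, 0 < τ n) ∧ ∀ n, τ n ≤ 1 :=
    ⟨_, hτ, fun n => by positivity, fun n => by
      rw [div_le_one (by positivity)]
      linarith [n.cast_nonneg (α := ℝ)]⟩
  have hτI : ∀ n, τ n ∈ Icc (0 : ℝ) 1 := fun n => ⟨(hτ0 n).le, hτ1 n⟩
  obtain ⟨K, hK⟩ := exists_lipschitzWith_gradient hu2 hper
  have hdiff : ∀ᵐ x, ∀ n, DifferentiableAt ℝ (gradientFlow u (τ n)) x :=
    ae_all_iff.2 fun n => (lipschitzWith_gradientFlow hu2 hper hK (τ n)).ae_differentiableAt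
  set ψ : ℕ → EuclideanSpace ℝ (Fin d) → ℝ := fun n x =>
    σ x * ((J (τ n) x * m x (τ n) - φ x) / τ n) with hψ
  have hψm : ∀ n, AEStronglyMeasurable (ψ n) volume := fun n =>
    (hσm.mul ((((hJm _).mul (hmm _).measurable).sub hφ.continuous.measurable).div_const
      _)).aestronglyMeasurable
  -- Discrete product rule: the first term tends to Δu φ, the second to ∇u·∇φ - Δu φ.
  have hψsplit : ∀ n x, (J (τ n) x * m x (τ n) - φ x) / τ n =
      (J (τ n) x - 1) / τ n * m x (τ n) + (m x (τ n) - m x 0) / τ n := fun n x => by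
    rw [hm0]
    ring
  set A := (D + 1) * (Real.exp D * P) + Real.exp D * (Q * L + D * P) with hA
  have hbound : Integrable ((Metric.closedBall (0 : EuclideanSpace ℝ (Fin d)) (R + L)).indicator
      fun _ => B * A) :=
    (integrable_indicator_iff measurableSet_closedBall).2
      (integrableOn_const (measure_closedBall_lt_top).ne)
  have hψB : ∀ᶠ n in Filter.atTop, ∀ᵐ x, ‖ψ n x‖ ≤
      (Metric.closedBall (0 : EuclideanSpace ℝ (Fin d)) (R + L)).indicator (fun _ => B * A) x := by
    filter_upwards [hτ'.eventually
      (eventually_abs_abs_det_gradientFlow_sub_le hu hper one_pos)] with n hn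
    filter_upwards [hdiff] with x hx
    by_cases hxR : x ∈ Metric.closedBall 0 (R + L)
    · rw [indicator_of_mem hxR, hψ]
      simp only
      rw [norm_mul, hψsplit]
      refine mul_le_mul (hσB x) ((norm_add_le _ _).trans (add_le_add ?_ ?_)) (norm_nonneg _) hB0
      · rw [norm_mul]
        refine mul_le_mul ?_ (hmB _ (hτI n) x) (norm_nonneg _) (by positivity)
        rw [norm_div, Real.norm_of_nonneg (hτ0 n).le, div_le_iff₀ (hτ0 n), Real.norm_eq_abs]
        have h1 := hn x (hx n)
        have h2 : |τ n * Δ u x| ≤ τ n * D := by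
          rw [abs_mul, abs_of_pos (hτ0 n)]
          exact mul_le_mul_of_nonneg_left (hD x) (hτ0 n).le
        have h3 := abs_sub_abs_le_abs_sub (J (τ n) x - 1) (τ n * Δ u x)
        have h4 : |J (τ n) x - 1 - τ n * Δ u x| ≤ 1 * τ n := h1
        linarith
      · rw [norm_div, Real.norm_of_nonneg (hτ0 n).le, div_le_iff₀ (hτ0 n)]
        exact hmL _ (hτI n) x
    · rw [indicator_of_notMem hxR, hψ]
      simp only
      rw [hψsplit, hmR _ (hτI n) x hxR, hmR 0 (by simp) x hxR]
      simp
  have hψ0 : ∀ᶠ n in Filter.atTop, ∫ x, ψ n x = 0 := by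
    filter_upwards [hψB] with n hn
    have hi : Integrable (ψ n) := hbound.mono' (hψm n) hn
    have hσφ : Integrable fun x => σ x * φ x :=
      (hφ.continuous.integrable_of_hasCompactSupport hφc).bdd_mul
        hσm.aestronglyMeasurable (Filter.Eventually.of_forall hσB)
    -- By the transport law of σ, the pulled back integrand is σJm = τψ + σφ, so ψ has integral
    -- zero.
    have h := integral_eq_integral_abs_det_gradientFlow hu2 hper (τ n) fun x => σ x * φ x
    have h2 : ∀ x, |(fderiv ℝ (gradientFlow u (τ n)) x).det| *
        (σ (gradientFlow u (τ n) x) * φ (gradientFlow u (τ n) x)) =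
        τ n * ψ n x + σ x * φ x := by
      intro x
      have := (hτ0 n).ne'
      simp only [hψ, hm, hJ, hσ]
      field_simp
      ring
    simp only [h2] at h
    rw [integral_add (hi.const_mul _) hσφ, integral_const_mul] at h
    have h3 : τ n * ∫ x, ψ n x = 0 := by linarith
    exact (mul_eq_zero.1 h3).resolve_left (hτ0 n).ne'
  have hlim : ∀ᵐ x, Filter.Tendsto (fun n => ψ n x) Filter.atTop
      (nhds (σ x * ⟪∇ u x, ∇ φ x⟫_ℝ)) := by
    filter_upwards [hdiff] with x hx
    have h1 : Filter.Tendsto (fun n => (J (τ n) x - 1) / τ n) Filter.atTop (nhds (Δ u x)) := by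
      rw [Metric.tendsto_nhds]
      intro ε hε
      filter_upwards [hτ'.eventually
        (eventually_abs_abs_det_gradientFlow_sub_le hu hper (half_pos hε))] with n hn
      have h := hn x (hx n)
      have : (J (τ n) x - 1) / τ n - Δ u x = (J (τ n) x - 1 - τ n * Δ u x) / τ n := by
        have := (hτ0 n).ne'
        field_simp
      rw [Real.dist_eq, this, abs_div, abs_of_pos (hτ0 n), div_lt_iff₀ (hτ0 n)]
      refine lt_of_le_of_lt h ?_
      have := hτ0 n
      gcongr
      linarith
    have h2 : Filter.Tendsto (fun n => m x (τ n)) Filter.atTop (nhds (φ x)) := by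
      rw [← hm0]
      exact (hmd x 0).continuousAt.tendsto.comp (hτ'.mono_right nhdsWithin_le_nhds)
    have h3 : Filter.Tendsto (fun n => (m x (τ n) - m x 0) / τ n) Filter.atTop
        (nhds (fderiv ℝ φ x (∇ u x) - Δ u x * φ x)) := by
      have h := (hasDerivAt_iff_tendsto_slope_zero.1 (hmd x 0)).comp
        (hτ'.mono_right (nhdsWithin_mono _ fun y hy => (ne_of_gt hy : y ≠ 0)))
      simp only [gradientFlow_zero hu2 hper, laplacianIntegral_zero, neg_zero, Real.exp_zero,
        one_mul] at h
      refine h.congr fun n => ?_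
      simp [div_eq_inv_mul]
    have h4 := ((h1.mul h2).add h3).const_mul (σ x)
    have h5 : Δ u x * φ x + (fderiv ℝ φ x (∇ u x) - Δ u x * φ x) = ⟪∇ u x, ∇ φ x⟫_ℝ := by
      rw [real_inner_comm, gradient, gradient, InnerProductSpace.toDual_symm_apply]
      ring
    rw [h5] at h4
    refine h4.congr fun n => ?_
    rw [hψ]
    simp only
    rw [hψsplit]
  have hT := tendsto_integral_filter_of_dominated_convergence _
    (Filter.Eventually.of_forall hψm) hψB hbound hlim
  exact tendsto_nhds_unique hT (tendsto_const_nhds.congr' (hψ0.mono fun n hn => hn.symm))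

/-- If the integrals of the laplacian along the flow are bounded, the exponential of their supremum
over all times is a conductivity: its logarithm changes along a trajectory by exactly the opposite
of the integral of the laplacian, so that the density is invariant under the flow. Taking a supremum
instead of a limit for large times makes the boundedness of trajectories unnecessary here. -/
theorem exists_isRealizableInTorusWith (hu : ContDiff ℝ 3 u) (hper : IsYPeriodic (∇ u))
    (h : LaplacianIntegralsBounded u) :
    ∃ σ : EuclideanSpace ℝ (Fin d) → ℝ, IsRealizableInTorusWith u σ ∧
      MemLp σ ⊤ volume ∧ MemLp (fun x => (σ x)⁻¹) ⊤ volume := by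
  have hu2 : ContDiff ℝ 2 u := hu.of_le (by norm_num)
  obtain ⟨C, hC⟩ := h.exists_forall_abs_le hu2 hper
  have hbdd : ∀ x, BddAbove (range fun t => laplacianIntegral u t x) := fun x =>
    ⟨C, by rintro _ ⟨t, rfl⟩; exact (le_abs_self _).trans (hC t x)⟩
  set S : EuclideanSpace ℝ (Fin d) → ℝ := fun x => ⨆ t, laplacianIntegral u t x with hS
  -- The supremum is over an uncountable family; measurability comes from lower semicontinuity.
  have hSm : Measurable S := (lowerSemicontinuous_ciSup hbdd fun t =>
    (continuous_laplacianIntegral hu2 hper t).lowerSemicontinuous).measurable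
  have hS0 : ∀ x, 0 ≤ S x := fun x => (laplacianIntegral_zero x).symm.le.trans (le_ciSup (hbdd x) 0)
  have hSC : ∀ x, S x ≤ C := fun x => ciSup_le fun t => (le_abs_self _).trans (hC t x)
  have hSX : ∀ t x, S (gradientFlow u t x) = S x - laplacianIntegral u t x := by
    intro t x
    have h1 : ∀ s, laplacianIntegral u s (gradientFlow u t x) =
        laplacianIntegral u (s + t) x - laplacianIntegral u t x := fun s => by
      rw [laplacianIntegral_add hu2 hper]
      ring
    simp only [hS, h1]
    have h2 : BddAbove (range fun s => laplacianIntegral u (s + t) x) :=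
      (hbdd x).mono (range_comp_subset_range (fun s => s + t) fun s => laplacianIntegral u s x)
    rw [← ciSup_sub h2]
    congr 1
    -- All real times are allowed in the supremum, so a time shift only reindexes it.
    exact (Equiv.addRight t).surjective.iSup_comp fun s => laplacianIntegral u s x
  have hSper : IsYPeriodic S := fun k x => by
    simp only [hS, laplacianIntegral_periodic hu2 hper _ k x]
  have hσm : Measurable fun x => Real.exp (S x) := hSm.exp
  have hσB : ∀ x, |Real.exp (S x)| ≤ Real.exp C := fun x => by
    rw [Real.abs_exp]
    exact Real.exp_le_exp.2 (hSC x)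
  have hLp : MemLp (fun x => Real.exp (S x)) ⊤ volume :=
    memLp_top_of_bound hσm.aestronglyMeasurable _ (Filter.Eventually.of_forall hσB)
  refine ⟨fun x => Real.exp (S x), ⟨fun x => Real.exp_pos _, ?_, fun k x => ?_, ?_⟩, hLp, ?_⟩
  · exact hLp.locallyIntegrable le_top
  · simp only [hSper k x]
  · refine divSigmaGradEqZero_of_forall_gradientFlow hu hper hσm hσB fun t x => ?_
    rw [← Real.exp_add, hSX, sub_eq_add_neg]
  · refine memLp_top_of_bound hσm.inv.aestronglyMeasurable 1 (Filter.Eventually.of_forall fun x => ?_)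
    rw [← Real.exp_neg, Real.norm_of_nonneg (Real.exp_pos _).le, Real.exp_le_one_iff]
    linarith [hS0 x]

end Flow

/-! ### Necessity for a conductivity of class C¹ -/

section Converse

variable {d : ℕ} {u σ : EuclideanSpace ℝ (Fin d) → ℝ}

/-- For a conductivity of class `C¹` the equation `div (σ ∇u) = 0` holds pointwise. -/
theorem DivSigmaGradEqZero.fderiv_apply_gradient_add (hu : ContDiff ℝ 2 u) (hσ : ContDiff ℝ 1 σ)
    (h : DivSigmaGradEqZero σ u) (x : EuclideanSpace ℝ (Fin d)) :
    fderiv ℝ σ x (∇ u x) + σ x * Δ u x = 0 := by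
  have hC := contDiff_gradient hu
  have hcomp : ∀ i, ContDiff ℝ 1 fun y => σ y * (∇ u y) i := fun i =>
    hσ.mul ((EuclideanSpace.proj i : EuclideanSpace ℝ (Fin d) →L[ℝ] ℝ).contDiff.comp hC)
  have hG : ∀ y, ∑ i, fderiv ℝ (fun y => σ y * (∇ u y) i) y (EuclideanSpace.single i 1) =
      fderiv ℝ σ y (∇ u y) + σ y * Δ u y := by
    intro y
    have h1 : ∀ i, HasFDerivAt (fun y => (∇ u y) i)
        ((EuclideanSpace.proj i : EuclideanSpace ℝ (Fin d) →L[ℝ] ℝ).comp (fderiv ℝ (∇ u) y)) y :=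
      fun i => (EuclideanSpace.proj i : EuclideanSpace ℝ (Fin d) →L[ℝ] ℝ).hasFDerivAt.comp y
        ((hC.differentiable one_ne_zero) y).hasFDerivAt
    have h2 : ∇ u y = ∑ i, (∇ u y) i • EuclideanSpace.single i (1 : ℝ) := by
      ext j
      simp [Finset.sum_apply, Pi.single_apply]
    have h3 : fderiv ℝ σ y (∇ u y) =
        ∑ i, (∇ u y) i * fderiv ℝ σ y (EuclideanSpace.single i 1) := by
      conv_lhs => rw [h2]
      simp
    rw [h3, laplacian_eq_sum_fderiv_gradient hu, Finset.mul_sum, ← Finset.sum_add_distrib]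
    refine Finset.sum_congr rfl fun i _ => ?_
    have h4 : HasFDerivAt (fun y => σ y * (∇ u y) i) _ y :=
      ((hσ.differentiable one_ne_zero) y).hasFDerivAt.mul (h1 i)
    rw [h4.fderiv]
    simp
    ring
  have hGc : Continuous fun y => fderiv ℝ σ y (∇ u y) + σ y * Δ u y :=
    ((hσ.continuous_fderiv one_ne_zero).clm_apply hC.continuous).add
      (hσ.continuous.mul (continuous_laplacian hu))
  -- Integration by parts, coordinate by coordinate, moves the derivative from φ to σ∇u; continuity
  -- then upgrades almost everywhere to everywhere.
  have hae : ∀ᵐ y, fderiv ℝ σ y (∇ u y) + σ y * Δ u y = 0 := by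
    refine ae_eq_zero_of_integral_contDiff_smul_eq_zero hGc.locallyIntegrable fun φ hφ hφc => ?_
    have hφ' : Continuous (fderiv ℝ φ) := hφ.continuous_fderiv (by simp)
    have hc : ∀ i, Continuous fun y =>
        fderiv ℝ (fun y => σ y * (∇ u y) i) y (EuclideanSpace.single i 1) := fun i =>
      ((hcomp i).continuous_fderiv one_ne_zero).clm_apply continuous_const
    have hcφ : ∀ i : Fin d, Continuous fun y => fderiv ℝ φ y (EuclideanSpace.single i 1) := fun i =>
      hφ'.clm_apply continuous_const
    have hi1 : ∀ i, Integrable fun y =>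
        fderiv ℝ (fun y => σ y * (∇ u y) i) y (EuclideanSpace.single i 1) * φ y := fun i =>
      ((hc i).mul hφ.continuous).integrable_of_hasCompactSupport hφc.mul_left
    have hi2 : ∀ i, Integrable fun y =>
        σ y * (∇ u y) i * fderiv ℝ φ y (EuclideanSpace.single i 1) := fun i =>
      ((hcomp i).continuous.mul (hcφ i)).integrable_of_hasCompactSupport
        (hφc.fderiv_apply ℝ _).mul_left
    have hparts : ∀ i, ∫ y, σ y * (∇ u y) i * fderiv ℝ φ y (EuclideanSpace.single i 1) =
        -∫ y, fderiv ℝ (fun y => σ y * (∇ u y) i) y (EuclideanSpace.single i 1) * φ y := fun i =>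
      integral_mul_fderiv_eq_neg_fderiv_mul_of_integrable (hi1 i) (hi2 i)
        (((hcomp i).continuous.mul hφ.continuous).integrable_of_hasCompactSupport hφc.mul_left)
        (fun y _ => (hcomp i).differentiable one_ne_zero y)
        (fun y _ => hφ.differentiable (by simp) y)
    have hinner : ∀ y, σ y * ⟪∇ u y, ∇ φ y⟫_ℝ =
        ∑ i, σ y * (∇ u y) i * fderiv ℝ φ y (EuclideanSpace.single i 1) := by
      intro y
      have h1 : ∀ i, fderiv ℝ φ y (EuclideanSpace.single i 1) = (∇ φ y) i := fun i => by
        have h : fderiv ℝ φ y (EuclideanSpace.single i 1) =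
            ⟪∇ φ y, EuclideanSpace.single i (1 : ℝ)⟫_ℝ := by
          rw [gradient, InnerProductSpace.toDual_symm_apply]
        rw [h, EuclideanSpace.inner_single_right]
        simp
      simp only [h1, PiLp.inner_apply, Finset.mul_sum]
      refine Finset.sum_congr rfl fun i _ => ?_
      simp
      ring
    have hz := h φ hφ hφc
    simp only [hinner] at hz
    rw [integral_finsetSum _ fun i _ => hi2 i] at hz
    simp only [hparts] at hz
    rw [Finset.sum_neg_distrib, ← integral_finsetSum _ fun i _ => hi1 i, neg_eq_zero] at hz
    rw [← hz]
    refine integral_congr_ae (Filter.Eventually.of_forall fun y => ?_)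
    simp only [← Finset.sum_mul, hG, smul_eq_mul]
    ring
  exact congrFun ((hGc.ae_eq_iff_eq volume continuous_zero).1 hae) x

theorem IsRealizableInTorusWith.laplacianVanishesAtCriticalPoints (hu : ContDiff ℝ 2 u)
    (hσ : ContDiff ℝ 1 σ) (h : IsRealizableInTorusWith u σ) :
    LaplacianVanishesAtCriticalPoints u := by
  intro x hx
  have h1 := h.div_eq_zero.fderiv_apply_gradient_add hu hσ x
  rw [hx, map_zero, zero_add] at h1
  exact (mul_eq_zero.1 h1).resolve_left (h.pos x).ne'

theorem IsRealizableInTorusWith.laplacianIntegralsBounded (hu : ContDiff ℝ 2 u)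
    (hper : IsYPeriodic (∇ u)) (hσ : ContDiff ℝ 1 σ) (h : IsRealizableInTorusWith u σ) :
    LaplacianIntegralsBounded u := by
  have hlogper : IsYPeriodic fun x => Real.log (σ x) := fun k x => by
    simp only [h.periodic k x]
  obtain ⟨C, hC⟩ := hlogper.exists_norm_le (hσ.continuous.log fun x => (h.pos x).ne')
  -- The integral is a difference of two values of log σ, each at most C in absolute value; the 1
  -- only secures positivity.
  refine ⟨2 * C + 1, by positivity, fun t _ x => ?_⟩
  have hd : ∀ s, HasDerivAt (fun s => -Real.log (σ (gradientFlow u s x)))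
      (Δ u (gradientFlow u s x)) s := by
    intro s
    have hp := h.pos (gradientFlow u s x)
    have h1 := ((((hσ.differentiable one_ne_zero) _).hasFDerivAt.comp_hasDerivAt s
      (hasDerivAt_gradientFlow hu hper x s)).log hp.ne').neg
    refine h1.congr_deriv ?_
    have h2 := h.div_eq_zero.fderiv_apply_gradient_add hu hσ (gradientFlow u s x)
    simp only [Function.comp_apply]
    rw [← neg_div, div_eq_iff hp.ne']
    linarith
  rw [intervalIntegral.integral_eq_sub_of_hasDerivAt (fun s _ => hd s)
    ((continuous_laplacian_gradientFlow hu hper x).intervalIntegrable _ _)]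
  have h1 := abs_le.1 (hC (gradientFlow u t x))
  have h2 := abs_le.1 (hC (gradientFlow u 0 x))
  rw [abs_le]
  constructor <;> linarith [h1.1, h1.2, h2.1, h2.2]

end Converse

theorem mainTheorem2 (d : ℕ) (hd : 2 ≤ d) (u : EuclideanSpace ℝ (Fin d) → ℝ)
    (hu : ContDiff ℝ 3 u) (hper : IsYPeriodic (∇ u))
    (hbdd : ∀ᵐ x : EuclideanSpace ℝ (Fin d),
      Bornology.IsBounded ((fun t : ℝ => gradientFlow u t x) '' Set.Ici 0) ∨
      Bornology.IsBounded ((fun t : ℝ => gradientFlow u t x) '' Set.Iic 0)) :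
    (LaplacianVanishesAtCriticalPoints u → LaplacianIntegralsBounded u →
      ∃ σ : EuclideanSpace ℝ (Fin d) → ℝ, IsRealizableInTorusWith u σ ∧
        MemLp σ ⊤ volume ∧ MemLp (fun x => (σ x)⁻¹) ⊤ volume) ∧
    (∀ σ : EuclideanSpace ℝ (Fin d) → ℝ, ContDiff ℝ 1 σ → IsRealizableInTorusWith u σ →
      LaplacianVanishesAtCriticalPoints u ∧ LaplacianIntegralsBounded u) := by
  have hu2 : ContDiff ℝ 2 u := hu.of_le (by norm_num)
  exact ⟨fun _ hb => exists_isRealizableInTorusWith hu hper hb, fun σ hσ hr =>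
    ⟨hr.laplacianVanishesAtCriticalPoints hu2 hσ, hr.laplacianIntegralsBounded hu2 hper hσ⟩⟩
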